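/- Let $d\ge 1$ and let $V:\mathbb{R}^d\to\mathbb{R}$ be a real-valued Lebesgue measurable function. Let $(1-\Delta)^{-1/2}$ be the bounded operator on $L^2(\mathbb{R}^d;\mathbb{C})$ that acts as multiplication by $(1+|\xi|^2)^{-1/2}$ on the Fourier side, and let $V$ act by multiplication. Consider the assumptions (A1) $V(-x)=V(x)$; (A2) $V(1-\Delta)^{-1/2}$ is a bounded operator on $L^2(\mathbb{R}^d;\mathbb{C})$ (in particular, it is defined on all of $L^2$); (A3) $(1-\Delta)^{-1/2}V(1-\Delta)^{-1/2}$ is a compact operator on $L^2(\mathbb{R}^d;\mathbb{C})$. For $0<p<\infty$, let $L^{p,\infty}(\mathbb{R}^d)$ be the set of measurable functions $f$ for which there is $c>0$ such that the Lebesgue measure of $\{x:|f(x)|>t\}$ is at most $c^p/t^p$ for all $t>0$. Let $L^p(\mathbb{R}^d)+L^\infty_0(\mathbb{R}^d)$ be the set of measurable functions $f$ for which there is a sequence $(f_n)$ in $L^p(\mathbb{R}^d)$ with $\lim_{n\to\infty}\|f-f_n\|_{L^\infty}=0$. Then $V$ satisfies (A2) and (A3) in each of the following cases: - $d=1$ and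 $V\in L^2(\mathbb{R})+L^\infty_0(\mathbb{R})$; - $d=2$ and $V\in L^p(\mathbb{R}^2)+L^\infty_0(\mathbb{R}^2)$ for some $p$ with $2<p<\infty$; - $d\ge 3$ and $V\in L^{d,\infty}(\mathbb{R}^d)$. In particular, in dimension $d=3$ each of the two Coulomb potentials $V(x)=\frac{1}{|x|}$ and $V(x)=-\frac{1}{|x|}$ satisfies (A1), (A2) and (A3). -/

import Mathlib

open MeasureTheory Filter
open scoped ENNReal Topology FourierTransform

noncomputable section

/-- Euclidean space of dimension `d`. -/
abbrev RSpace (d : ℕ) : Type := EuclideanSpace ℝ (Fin d)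

/-- The one-particle Hilbert space `L²(ℝ^d; ℂ)`. -/
abbrev L2Space (d : ℕ) : Type := Lp ℂ 2 (volume : Measure (RSpace d))

/-- The symbol of `(1 - Δ)^{-1/2}`. Mathlib's Fourier transform has the kernel
`exp (-2 π i ⟨x, ξ⟩)`, so that `-Δ` has the symbol `(2 π ‖ξ‖)^2`. -/
def invSqrtSymbol (d : ℕ) (ξ : RSpace d) : ℂ :=
  (((1 + (2 * Real.pi * ‖ξ‖) ^ 2) ^ (-(1 / 2) : ℝ) : ℝ) : ℂ)

theorem memLp_invSqrtSymbol (d : ℕ) :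
    MemLp (invSqrtSymbol d) ∞ (volume : Measure (RSpace d)) := by
  refine memLp_top_of_bound (C := 1) ?_ (ae_of_all _ fun ξ => ?_)
  · refine Continuous.aestronglyMeasurable ?_
    unfold invSqrtSymbol
    refine Complex.continuous_ofReal.comp ?_
    refine Continuous.rpow_const (by fun_prop) fun ξ => Or.inl ?_
    positivity
  · unfold invSqrtSymbol
    rw [Complex.norm_real, Real.norm_eq_abs, abs_of_nonneg (by positivity)]
    refine Real.rpow_le_one_of_one_le_of_nonpos ?_ (by norm_num)
    have : 0 ≤ (2 * Real.pi * ‖ξ‖) ^ 2 := sq_nonneg _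
    linarith

/-- Multiplication by the symbol of `(1 - Δ)^{-1/2}`, as a bounded operator on `L²(ℝ^d; ℂ)`. -/
def invSqrtSymbolMul (d : ℕ) : L2Space d →L[ℂ] L2Space d :=
  (ContinuousLinearMap.mul ℂ ℂ).holderL volume ∞ 2 2 ((memLp_invSqrtSymbol d).toLp)

/-- The operator `(1 - Δ)^{-1/2}` on `L²(ℝ^d; ℂ)`: the Fourier multiplier with the symbol
of `(1 - Δ)^{-1/2}`. -/
def invSqrtLaplacian (d : ℕ) : L2Space d →L[ℂ] L2Space d :=
  ((Lp.fourierTransformₗᵢ (RSpace d) ℂ).symm.toContinuousLinearEquiv :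
      L2Space d →L[ℂ] L2Space d) ∘L
    invSqrtSymbolMul d ∘L
    ((Lp.fourierTransformₗᵢ (RSpace d) ℂ).toContinuousLinearEquiv :
      L2Space d →L[ℂ] L2Space d)

/-- `f ∈ L^{p,∞}(ℝ^d)` (weak `L^p`), for `0 < p < ∞`. -/
def MemWeakLp {d : ℕ} (f : RSpace d → ℝ) (p : ℝ) : Prop :=
  AEStronglyMeasurable f volume ∧
    ∃ c : ℝ, 0 < c ∧ ∀ t : ℝ, 0 < t →
      volume {x : RSpace d | t < |f x|} ≤ ENNReal.ofReal (c ^ p / t ^ p)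

/-- `f ∈ L^p(ℝ^d) + L^∞_0(ℝ^d)`: `f` is a limit, in the `L^∞` norm, of functions in `L^p`. -/
def MemLpAddLinfZero {d : ℕ} (f : RSpace d → ℝ) (p : ℝ≥0∞) : Prop :=
  AEStronglyMeasurable f volume ∧
    ∃ g : ℕ → RSpace d → ℝ, (∀ n, MemLp (g n) p volume) ∧
      Tendsto (fun n => eLpNorm (f - g n) ∞ volume) atTop (𝓝 0)

/-- Assumption (A1): the (real-valued) potential is even. -/
def PotentialEven {d : ℕ} (V : RSpace d → ℝ) : Prop :=
  ∀ x, V (-x) = V x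

/-- Assumption (A2): `V (1 - Δ)^{-1/2}` is a bounded operator on `L²(ℝ^d; ℂ)`, where `V` acts by
multiplication. In particular `V · (1 - Δ)^{-1/2} u` lies in `L²` for every `u` in `L²`. -/
def PotentialBounded {d : ℕ} (V : RSpace d → ℝ) : Prop :=
  ∃ T : L2Space d →L[ℂ] L2Space d,
    ∀ u : L2Space d, (T u : RSpace d → ℂ) =ᵐ[volume]
      fun x => (V x : ℂ) * (invSqrtLaplacian d u : RSpace d → ℂ) x

/-- Assumption (A3): `(1 - Δ)^{-1/2} V (1 - Δ)^{-1/2}` is a compact operator on `L²(ℝ^d; ℂ)`: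
there is a compact operator `K` such that for every `u` in `L²` the product
`V · (1 - Δ)^{-1/2} u` is an `L²` function `w`, and `K u = (1 - Δ)^{-1/2} w`. -/
def PotentialCompact {d : ℕ} (V : RSpace d → ℝ) : Prop :=
  ∃ K : L2Space d →L[ℂ] L2Space d, IsCompactOperator K ∧
    ∀ u : L2Space d, ∃ w : L2Space d,
      ((w : RSpace d → ℂ) =ᵐ[volume]
        fun x => (V x : ℂ) * (invSqrtLaplacian d u : RSpace d → ℂ) x) ∧
      K u = invSqrtLaplacian d w

end

/-! Write `D` for `(1 - Δ)^{-1/2}`, with symbol `m`.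

Compactness follows from boundedness of `V D` once `V` is a uniform limit of functions `W` in `L²`.
Since `‖D‖ ≤ 1`, uniform convergence of potentials gives norm convergence of `D V D`, so it suffices
to treat `D W D`. Truncating `m` in the left factor to a ball makes it square integrable. Then
(truncated symbol) ∘ 𝓕 ∘ `W` has an `L²` kernel and is compact, and the truncation error is small
because `m` decays (`isCompactOperator_invSqrtLaplacian_comp`, `PotentialBounded.compact`).

Boundedness for weak `L^p`, `p > 2`, `p ≥ d`, is proved by hand (`MemWeakLp.potentialBounded`).
Where `|V| ~ 2^j`, split `D u` at frequency `2^j`. The high part is estimated in `L²`: summing `4^j`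
over `2^j ≤ |ξ|` costs `|ξ|²`, which `m²` absorbs. The low part is estimated in `L^∞` by the `L¹`
norm of its Fourier transform. The smallness of the level set leaves a factor `r^j` with `r =
2^{1-p/2} < 1`, and a discrete Young inequality over dyadic annuli sums it. The condition `d ≤ p`
balances annulus volume against the decay of `m`; equality is allowed.

For `d = 1`, `m` itself is in `L²`, so `D u` is bounded and `V ∈ L²` suffices. For `d = 2`, `L^p`
lies in weak `L^p`. -/

noncomputable section

/-! ### The inverse Fourier transform on `L²` as an integral -/

/-- The inverse Fourier transform on `L²` agrees with the integral on `L¹ ∩ L²`. -/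
theorem coeFn_fourierInv_ae_eq {d : ℕ} (f : L2Space d) (hf : Integrable f) :
    ((𝓕⁻ f : L2Space d) : RSpace d → ℂ) =ᵐ[volume] 𝓕⁻ (f : RSpace d → ℂ) := by
  have hloc : LocallyIntegrable ((𝓕⁻ f : L2Space d) : RSpace d → ℂ) volume :=
    (Lp.memLp _).locallyIntegrable (by norm_num)
  have hL : Continuous fun p : RSpace d × RSpace d => (-innerₗ (RSpace d)) p.1 p.2 := by
    simp only [LinearMap.neg_apply, innerₗ_apply_apply]
    fun_prop
  have hI : ∀ (g : RSpace d → ℂ) (x : RSpace d),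
      VectorFourier.fourierIntegral Real.fourierChar volume (-innerₗ (RSpace d)) g x
        = 𝓕⁻ g x := by
    intro g x
    simp [VectorFourier.fourierIntegral, Real.fourierInv_eq]
  have hflip : (-innerₗ (RSpace d)).flip = -innerₗ (RSpace d) := by
    ext x y
    simp [real_inner_comm]
  have hcont : Continuous (𝓕⁻ (f : RSpace d → ℂ)) := by
    rw [← funext (hI f)]
    exact VectorFourier.fourierIntegral_continuous Real.continuous_fourierChar hL hf
  -- Test against smooth compactly supported `g`: the `L²` transform moves onto `g` by compatibility
  -- with tempered distributions, the integral one by Fubini.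
  refine ae_eq_of_integral_contDiff_smul_eq hloc hcont.locallyIntegrable fun g hg hgc => ?_
  have hg₁ : HasCompactSupport (Complex.ofRealCLM ∘ g) := hgc.comp_left rfl
  have hg₂ : ContDiff ℝ (⊤ : ℕ∞) (Complex.ofRealCLM ∘ g) := by fun_prop
  set φ : SchwartzMap (RSpace d) ℂ := hg₁.toSchwartzMap hg₂
  have h1 := DFunLike.congr_fun (Lp.fourierInv_toTemperedDistribution_eq f) φ
  rw [TemperedDistribution.fourierInv_apply, Lp.toTemperedDistribution_apply,
    Lp.toTemperedDistribution_apply] at h1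
  have hφ : ∀ x, φ x = (g x : ℂ) := fun x => rfl
  have h2 := VectorFourier.integral_fourierIntegral_smul_eq_flip (μ := volume) (ν := volume)
    (L := -innerₗ (RSpace d)) (f := φ) (g := f) Real.continuous_fourierChar hL φ.integrable hf
  rw [hflip] at h2
  simp only [hI, ← SchwartzMap.fourierInv_coe] at h2
  rw [h1] at h2
  simpa [hφ] using h2

theorem continuous_fourierInv_of_integrable {d : ℕ} {f : RSpace d → ℂ} (hf : Integrable f) :
    Continuous (𝓕⁻ f) := by
  rw [show 𝓕⁻ f = fun x => 𝓕 f (-x) from funext fun x => Real.fourierInv_eq_fourier_neg _ _]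
  exact (VectorFourier.fourierIntegral_continuous Real.continuous_fourierChar
    (by exact continuous_inner) hf).comp continuous_neg

theorem enorm_fourierInv_le {d : ℕ} (f : RSpace d → ℂ) (x : RSpace d) :
    ‖𝓕⁻ f x‖ₑ ≤ ∫⁻ ξ, ‖f ξ‖ₑ := by
  rw [Real.fourierInv_eq]
  refine (enorm_integral_le_lintegral_enorm _).trans_eq ?_
  simp only [← ofReal_norm, Circle.norm_smul]

/-! ### Compactness from square integrable kernels -/

/-- Integration against a square integrable kernel is a compact operator. -/
theorem isCompactOperator_lpPairing {α : Type*} [MeasurableSpace α] {μ : Measure α}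
    {H : Type*} [NormedAddCommGroup H] [NormedSpace ℂ H] [NormedSpace ℝ H]
    [SMulCommClass ℝ ℂ H] [CompleteSpace H] (k : Lp H 2 μ) :
    IsCompactOperator (((ContinuousLinearMap.lsmul ℂ ℂ : ℂ →L[ℂ] H →L[ℂ] H).lpPairing
      μ 2 2).flip k) := by
  have h2 : (2 : ℝ≥0∞) ≠ ∞ := ENNReal.ofNat_ne_top
  induction k using Lp.induction h2 with
  | @indicatorConst c s hs hμs =>
    -- For an indicator kernel the operator factors through `ℂ`, hence has rank at most one; sums
    -- and norm limits then give every kernel.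
    have : (((ContinuousLinearMap.lsmul ℂ ℂ : ℂ →L[ℂ] H →L[ℂ] H).lpPairing μ 2 2).flip
        (Lp.simpleFunc.indicatorConst 2 hs hμs.ne c : Lp H 2 μ) : Lp ℂ 2 μ → H)
        = (ContinuousLinearMap.toSpanSingleton ℂ c) ∘
          (((ContinuousLinearMap.mul ℂ ℂ).lpPairing μ 2 2).flip
            (indicatorConstLp 2 hs hμs.ne (1 : ℂ))) := by
      funext f
      simp only [ContinuousLinearMap.flip_apply, ContinuousLinearMap.lpPairing_eq_integral,
        Function.comp_apply, ContinuousLinearMap.toSpanSingleton_apply,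
        ContinuousLinearMap.mul_apply', ← integral_smul_const]
      refine integral_congr_ae ?_
      rw [Lp.simpleFunc.coe_indicatorConst]
      filter_upwards [indicatorConstLp_coeFn (p := 2) (hs := hs) (hμs := hμs.ne) (c := c),
        indicatorConstLp_coeFn (p := 2) (hs := hs) (hμs := hμs.ne) (c := (1 : ℂ))] with x h1 h2
      rw [h1, h2]
      by_cases hx : x ∈ s <;> simp [hx]
    rw [this]
    exact (isCompactOperator_of_locallyCompactSpace_rng
      (ContinuousLinearMap.toSpanSingleton ℂ c)).comp_clm _
  | add hf hg _ h1 h2 =>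
    rw [map_add]
    exact h1.add h2
  | isClosed =>
    exact isClosed_setOfPred_isCompactOperator.preimage (ContinuousLinearMap.continuous _)

/-- Multiplication of a function in `L²` by the character `ξ ↦ exp (-2 π i ⟨ξ, x⟩)`. -/
def modulate {d : ℕ} (c : L2Space d) (x : RSpace d) : L2Space d :=
  MemLp.toLp (fun ξ => Real.fourierChar (-inner ℝ ξ x) • c ξ) <| by
    refine (Lp.memLp c).of_le ?_ (ae_of_all _ fun ξ => (Circle.norm_smul _ _).le)
    have : Continuous fun ξ : RSpace d => Real.fourierChar (-inner ℝ ξ x) :=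
      Real.continuous_fourierChar.comp (by fun_prop)
    exact this.aestronglyMeasurable.smul (Lp.memLp c).1

/-- Turns pairing with a modulated function into a pointwise value of an inverse Fourier integral.
-/
theorem inner_modulate {d : ℕ} (c v : L2Space d) (x : RSpace d) :
    inner ℂ (modulate c x) v = 𝓕⁻ (fun ξ => star (c ξ) * v ξ) x := by
  rw [L2.inner_def, Real.fourierInv_eq]
  refine integral_congr_ae ?_
  filter_upwards [MemLp.coeFn_toLp (p := 2) (μ := volume)
    (f := fun ξ => Real.fourierChar (-inner ℝ ξ x) • c ξ) _] with ξ h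
  rw [modulate, h]
  simp only [RCLike.inner_apply, Circle.smul_def, smul_eq_mul, map_mul, AddChar.map_neg_eq_inv,
    ← Circle.coe_inv_eq_conj, inv_inv]
  simp only [RCLike.star_def]
  ring

theorem norm_modulate {d : ℕ} (c : L2Space d) (x : RSpace d) : ‖modulate c x‖ = ‖c‖ := by
  rw [modulate, Lp.norm_toLp, Lp.norm_def]
  congr 1
  exact eLpNorm_congr_norm_ae (ae_of_all _ fun ξ => Circle.norm_smul _ _)

/-- Weak continuity, from continuity of Fourier integrals of `L¹` functions, together with constant
norm gives strong continuity. It supplies the measurability of the vector-valued kernel below. -/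
theorem continuous_modulate {d : ℕ} (c : L2Space d) : Continuous (modulate c) := by
  have hint : ∀ v : L2Space d, Integrable (fun ξ => star (c ξ) * v ξ) := fun v =>
    (Lp.memLp c).star.integrable_mul (Lp.memLp v)
  have hc : ∀ v : L2Space d, Continuous fun x => inner ℂ (modulate c x) v := fun v => by
    simp only [inner_modulate]
    exact continuous_fourierInv_of_integrable (hint v)
  rw [continuous_iff_continuousAt]
  intro y
  rw [ContinuousAt, tendsto_iff_norm_sub_tendsto_zero]
  have h : ∀ x, ‖modulate c x - modulate c y‖
      = Real.sqrt (‖c‖ ^ 2 - 2 * RCLike.re (inner ℂ (modulate c x) (modulate c y)) + ‖c‖ ^ 2) := by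
    intro x
    rw [eq_comm, Real.sqrt_eq_iff_eq_sq _ (norm_nonneg _)]
    · rw [@norm_sub_sq ℂ, norm_modulate, norm_modulate]
    · have := @norm_sub_sq ℂ _ _ _ _ (modulate c x) (modulate c y)
      rw [norm_modulate, norm_modulate] at this
      rw [← this]
      positivity
  simp only [h]
  have h2 : Continuous fun x => Real.sqrt (‖c‖ ^ 2
      - 2 * RCLike.re (inner ℂ (modulate c x) (modulate c y)) + ‖c‖ ^ 2) := by
    have := hc (modulate c y)
    fun_prop
  convert h2.tendsto y using 2
  rw [inner_self_eq_norm_sq, norm_modulate, eq_comm, Real.sqrt_eq_zero']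
  linarith

/-- Multiplication by an essentially bounded function, on `L²`. -/
def mulOp {d : ℕ} {c : RSpace d → ℂ} (hc : MemLp c ∞) : L2Space d →L[ℂ] L2Space d :=
  (ContinuousLinearMap.mul ℂ ℂ).holderL volume ∞ 2 2 hc.toLp

theorem coeFn_mulOp {d : ℕ} {c : RSpace d → ℂ} (hc : MemLp c ∞) (u : L2Space d) :
    (mulOp hc u : RSpace d → ℂ) =ᵐ[volume] fun x => c x * u x := by
  refine ((ContinuousLinearMap.mul ℂ ℂ).coeFn_holder (r := 2) hc.toLp u).trans ?_
  filter_upwards [hc.coeFn_toLp] with x hx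
  simp [hx]

theorem norm_mulOp_le {d : ℕ} {c : RSpace d → ℂ} (hc : MemLp c ∞) {C : ℝ} (hC : 0 ≤ C)
    (h : ∀ᵐ x, ‖c x‖ ≤ C) : ‖mulOp hc‖ ≤ C := by
  refine ContinuousLinearMap.opNorm_le_bound _ hC fun u => ?_
  refine Lp.norm_le_mul_norm_of_ae_le_mul ?_
  filter_upwards [coeFn_mulOp hc u, h] with x h1 h2
  rw [h1, norm_mul]
  gcongr

/-- The kernel `x ↦ W x • modulate c x` has norm `|W x| ‖c‖`, so it is square integrable with values
in `L²`. The operator `S` is defined even on those `h` for which `W h` is not in `L²`. -/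
theorem exists_isCompactOperator_mulOp_fourier {d : ℕ} {c : RSpace d → ℂ} (hc : MemLp c ∞)
    (hc2 : MemLp c 2) {W : RSpace d → ℝ} (hW : MemLp W 2) :
    ∃ S : L2Space d →L[ℂ] L2Space d, IsCompactOperator S ∧ ∀ h w : L2Space d,
      (w : RSpace d → ℂ) =ᵐ[volume] (fun x => (W x : ℂ) * h x) → mulOp hc (𝓕 w) = S h := by
  have hk : MemLp (fun x => (W x : ℂ) • modulate hc2.toLp x) 2 := by
    refine (hW.norm.const_mul ‖hc2.toLp‖).of_le ?_ (ae_of_all _ fun x => ?_)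
    · exact (Complex.continuous_ofReal.comp_aestronglyMeasurable hW.1).smul
        (continuous_modulate _).aestronglyMeasurable
    · rw [norm_smul, norm_modulate, mul_comm]
      simp
  refine ⟨_, isCompactOperator_lpPairing hk.toLp, fun h w hw => ?_⟩
  refine ext_inner_left ℂ fun v => ?_
  have hint : Integrable (fun x => h x • (W x : ℂ) • modulate hc2.toLp x) :=
    memLp_one_iff_integrable.1 (hk.smul (Lp.memLp h))
  have hS : ((ContinuousLinearMap.lsmul ℂ ℂ : ℂ →L[ℂ] L2Space d →L[ℂ] L2Space d).lpPairing
      volume 2 2).flip hk.toLp h = ∫ x, h x • (W x : ℂ) • modulate hc2.toLp x := by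
    rw [ContinuousLinearMap.flip_apply, ContinuousLinearMap.lpPairing_eq_integral]
    refine integral_congr_ae ?_
    filter_upwards [hk.coeFn_toLp] with x hx
    rw [hx]
    rfl
  rw [hS, ← integral_inner hint]
  -- Pairing with `v` moves `c` to the other side; the product `f` is in `L¹ ∩ L²`, so its inverse
  -- transform is an honest integral.
  set f : L2Space d := mulOp hc.star v with hf
  have hfe : (f : RSpace d → ℂ) =ᵐ[volume] fun ξ => star ((hc2.toLp : L2Space d) ξ) * v ξ := by
    filter_upwards [coeFn_mulOp hc.star v, hc2.coeFn_toLp] with ξ h1 h2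
    rw [hf, h1, h2]
    rfl
  have hfi : Integrable f := by
    refine Integrable.congr ?_ hfe.symm
    exact (Lp.memLp hc2.toLp).star.integrable_mul (Lp.memLp v)
  have h1 : inner ℂ v (mulOp hc (𝓕 w)) = inner ℂ f (𝓕 w) := by
    rw [L2.inner_def, L2.inner_def]
    refine integral_congr_ae ?_
    filter_upwards [coeFn_mulOp hc.star v, coeFn_mulOp hc (𝓕 w)] with ξ h1 h2
    rw [hf, h1, h2]
    simp only [RCLike.inner_apply, Pi.star_apply, RCLike.star_def, map_mul, RCLike.conj_conj]
    ring
  have h2 : inner ℂ f (𝓕 w) = inner ℂ (𝓕⁻ f) w := by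
    rw [← Lp.inner_fourier_eq (𝓕⁻ f) w, FourierTransform.fourier_fourierInv_eq]
  rw [h1, h2, L2.inner_def]
  refine integral_congr_ae ?_
  filter_upwards [hw, coeFn_fourierInv_ae_eq f hfi] with x h3 h4
  have h5 : 𝓕⁻ (f : RSpace d → ℂ) x = inner ℂ (modulate hc2.toLp x) v := by
    rw [inner_modulate, Real.fourierInv_eq, Real.fourierInv_eq]
    refine integral_congr_ae ?_
    filter_upwards [hfe] with ξ h6
    rw [h6]
  rw [h3, h4, h5, inner_smul_right, inner_smul_right, RCLike.inner_apply, inner_conj_symm]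
  ring

/-! ### Bounds on the symbol and compactness for `L²` potentials -/

theorem invSqrtLaplacian_apply {d : ℕ} (u : L2Space d) :
    invSqrtLaplacian d u = 𝓕⁻ (mulOp (memLp_invSqrtSymbol d) (𝓕 u)) := rfl

theorem norm_fourierInv_L2 {d : ℕ} (u : L2Space d) : ‖𝓕⁻ u‖ = ‖u‖ :=
  (Lp.fourierTransformₗᵢ (RSpace d) ℂ).symm.norm_map u

theorem norm_invSqrtSymbol {d : ℕ} (ξ : RSpace d) :
    ‖invSqrtSymbol d ξ‖ = (1 + (2 * Real.pi * ‖ξ‖) ^ 2) ^ (-(1 / 2) : ℝ) := by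
  rw [invSqrtSymbol, Complex.norm_real, Real.norm_of_nonneg (by positivity)]

theorem norm_invSqrtSymbol_le_one {d : ℕ} (ξ : RSpace d) : ‖invSqrtSymbol d ξ‖ ≤ 1 := by
  rw [norm_invSqrtSymbol]
  exact Real.rpow_le_one_of_one_le_of_nonpos (by nlinarith [sq_nonneg (2 * Real.pi * ‖ξ‖)])
    (by norm_num)

theorem norm_invSqrtSymbol_le_inv {d : ℕ} {R : ℝ} (hR : 0 < R) {ξ : RSpace d} (h : R ≤ ‖ξ‖) :
    ‖invSqrtSymbol d ξ‖ ≤ R⁻¹ := by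
  have h1 : R ^ 2 ≤ 1 + (2 * Real.pi * ‖ξ‖) ^ 2 := by
    have : R ≤ 2 * Real.pi * ‖ξ‖ := by
      nlinarith [Real.pi_gt_three, norm_nonneg ξ]
    nlinarith
  rw [norm_invSqrtSymbol]
  refine (Real.rpow_le_rpow_of_nonpos (by positivity) h1 (by norm_num)).trans_eq ?_
  rw [← Real.rpow_natCast, ← Real.rpow_mul hR.le, ← Real.rpow_neg_one]
  norm_num

theorem continuous_invSqrtSymbol (d : ℕ) : Continuous (invSqrtSymbol d) := by
  unfold invSqrtSymbol
  refine Complex.continuous_ofReal.comp (Continuous.rpow_const (by fun_prop) fun ξ => Or.inl ?_)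
  positivity

theorem norm_invSqrtLaplacian_le (d : ℕ) (u : L2Space d) : ‖invSqrtLaplacian d u‖ ≤ ‖u‖ := by
  rw [invSqrtLaplacian_apply, norm_fourierInv_L2]
  have := (mulOp (memLp_invSqrtSymbol d)).le_of_opNorm_le
    (norm_mulOp_le _ zero_le_one (ae_of_all _ norm_invSqrtSymbol_le_one)) (𝓕 u)
  rwa [one_mul, Lp.norm_fourier_eq] at this

theorem isCompactOperator_invSqrtLaplacian_comp {d : ℕ} {W : RSpace d → ℝ} (hW : MemLp W 2)
    (T : L2Space d →L[ℂ] L2Space d)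
    (hT : ∀ u : L2Space d, (T u : RSpace d → ℂ) =ᵐ[volume]
      fun x => (W x : ℂ) * (invSqrtLaplacian d u : RSpace d → ℂ) x) :
    IsCompactOperator (invSqrtLaplacian d ∘L T) := by
  -- Truncation at radius `n + 1` leaves a symbol of size at most `1 / (n + 1)`, which is the rate
  -- of norm convergence.
  set c : ℕ → RSpace d → ℂ := fun n => (Metric.ball 0 (n + 1)).indicator (invSqrtSymbol d) with hc
  have hc1 : ∀ n, MemLp (c n) ∞ := fun n =>
    (memLp_invSqrtSymbol d).indicator Metric.isOpen_ball.measurableSet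
  have hc2 : ∀ n, MemLp (c n) 2 := fun n => by
    rw [hc, memLp_indicator_iff_restrict Metric.isOpen_ball.measurableSet]
    have : IsFiniteMeasure (volume.restrict (Metric.ball (0 : RSpace d) (n + 1))) :=
      ⟨by simpa using measure_ball_lt_top⟩
    exact ((memLp_invSqrtSymbol d).restrict _).mono_exponent le_top
  choose S hS hSw using fun n => exists_isCompactOperator_mulOp_fourier (hc1 n) (hc2 n) hW
  set F : L2Space d →L[ℂ] L2Space d :=
    ((Lp.fourierTransformₗᵢ (RSpace d) ℂ).symm.toContinuousLinearEquiv : L2Space d →L[ℂ] L2Space d)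
  have hcomp : ∀ n, IsCompactOperator (F ∘L S n ∘L invSqrtLaplacian d) := fun n =>
    ((hS n).comp_clm (invSqrtLaplacian d)).clm_comp F
  refine isCompactOperator_of_tendsto (l := atTop) ?_ (Eventually.of_forall hcomp)
  rw [tendsto_iff_norm_sub_tendsto_zero]
  have hlim : Tendsto (fun n : ℕ => 1 / ((n : ℝ) + 1) * ‖T‖) atTop (𝓝 0) := by
    simpa using tendsto_one_div_add_atTop_nhds_zero_nat.mul_const ‖T‖
  refine squeeze_zero (fun _ => norm_nonneg _) (fun n => ?_) hlim
  refine ContinuousLinearMap.opNorm_le_bound _ (by positivity) fun u => ?_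
  have h1 : (F ∘L S n ∘L invSqrtLaplacian d - invSqrtLaplacian d ∘L T) u
      = F (mulOp ((hc1 n).sub (memLp_invSqrtSymbol d)) (𝓕 (T u))) := by
    have : mulOp ((hc1 n).sub (memLp_invSqrtSymbol d)) (𝓕 (T u))
        = mulOp (hc1 n) (𝓕 (T u)) - mulOp (memLp_invSqrtSymbol d) (𝓕 (T u)) := by
      refine Lp.ext ?_
      filter_upwards [coeFn_mulOp ((hc1 n).sub (memLp_invSqrtSymbol d)) (𝓕 (T u)),
        coeFn_mulOp (hc1 n) (𝓕 (T u)), coeFn_mulOp (memLp_invSqrtSymbol d) (𝓕 (T u)),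
        Lp.coeFn_sub (mulOp (hc1 n) (𝓕 (T u))) (mulOp (memLp_invSqrtSymbol d) (𝓕 (T u)))]
        with ξ h1 h2 h3 h4
      rw [h1, h4, Pi.sub_apply, Pi.sub_apply, h2, h3, sub_mul]
    rw [this, map_sub, hSw n _ _ (hT u)]
    rfl
  rw [h1]
  refine (norm_fourierInv_L2 _).le.trans ?_
  refine (ContinuousLinearMap.le_of_opNorm_le _ (norm_mulOp_le _ (C := 1 / ((n : ℝ) + 1))
    (by positivity) (ae_of_all _ fun ξ => ?_)) _).trans ?_
  · by_cases hξ : ξ ∈ Metric.ball (0 : RSpace d) (n + 1)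
    · simp only [hc, Pi.sub_apply, Set.indicator_of_mem hξ, sub_self, norm_zero]
      positivity
    · simp only [Pi.sub_apply, hc, Set.indicator_of_notMem hξ, zero_sub, norm_neg, one_div]
      refine norm_invSqrtSymbol_le_inv (by positivity) ?_
      simpa using hξ
  · rw [Lp.norm_fourier_eq, mul_assoc]
    gcongr
    exact T.le_opNorm u

/-! ### Compactness from boundedness, and a criterion for boundedness -/

theorem potentialBounded_add {d : ℕ} {V W : RSpace d → ℝ} (hV : PotentialBounded V)
    (hW : PotentialBounded W) : PotentialBounded (V + W) := by
  obtain ⟨S, hS⟩ := hV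
  obtain ⟨T, hT⟩ := hW
  refine ⟨S + T, fun u => ?_⟩
  filter_upwards [hS u, hT u, Lp.coeFn_add (S u) (T u)] with x h1 h2 h3
  rw [add_apply, h3, Pi.add_apply, h1, h2, Pi.add_apply]
  push_cast
  ring

theorem potentialBounded_of_memLp_top {d : ℕ} {V : RSpace d → ℝ} (hV : MemLp V ∞) :
    PotentialBounded V :=
  ⟨mulOp hV.ofReal ∘L invSqrtLaplacian d, fun _ => coeFn_mulOp _ _⟩

theorem PotentialBounded.compact {d : ℕ} {V : RSpace d → ℝ} (hV : PotentialBounded V)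
    (hVm : AEStronglyMeasurable V)
    (h : ∀ ε : ℝ, 0 < ε → ∃ W : RSpace d → ℝ, MemLp W 2 ∧ ∀ᵐ x, |V x - W x| ≤ ε) :
    PotentialCompact V := by
  obtain ⟨T, hT⟩ := hV
  refine ⟨invSqrtLaplacian d ∘L T, ?_, fun u => ⟨T u, hT u, rfl⟩⟩
  have hpos : ∀ n : ℕ, (0 : ℝ) < 1 / ((n : ℝ) + 1) := fun n => by positivity
  choose W hW hVW using fun n : ℕ => h (1 / ((n : ℝ) + 1)) (hpos n)
  have hD : ∀ n, MemLp (fun x => ((V x - W n x : ℝ) : ℂ)) ∞ := fun n =>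
    (memLp_top_of_bound (hVm.sub (hW n).1) _ (hVW n)).ofReal
  -- This is multiplication by `W n` after `invSqrtLaplacian d`, bounded as a difference of bounded
  -- operators.
  set T' : ℕ → L2Space d →L[ℂ] L2Space d := fun n => T - mulOp (hD n) ∘L invSqrtLaplacian d
    with hT'
  have hc : ∀ n, IsCompactOperator (invSqrtLaplacian d ∘L T' n) := fun n => by
    refine isCompactOperator_invSqrtLaplacian_comp (hW n) _ fun u => ?_
    filter_upwards [hT u, coeFn_mulOp (hD n) (invSqrtLaplacian d u),
      Lp.coeFn_sub (T u) (mulOp (hD n) (invSqrtLaplacian d u))] with x h1 h2 h3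
    rw [hT', sub_apply, ContinuousLinearMap.comp_apply, h3, Pi.sub_apply,
      h1, h2]
    push_cast
    ring
  refine isCompactOperator_of_tendsto (l := atTop) ?_ (Eventually.of_forall hc)
  rw [tendsto_iff_norm_sub_tendsto_zero]
  refine squeeze_zero (fun _ => norm_nonneg _) (fun n => ?_)
    tendsto_one_div_add_atTop_nhds_zero_nat
  refine ContinuousLinearMap.opNorm_le_bound _ (hpos n).le fun u => ?_
  have h1 : (invSqrtLaplacian d ∘L T' n - invSqrtLaplacian d ∘L T) u
      = -invSqrtLaplacian d (mulOp (hD n) (invSqrtLaplacian d u)) := by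
    simp [hT']
  rw [h1, norm_neg]
  refine (norm_invSqrtLaplacian_le _ _).trans ?_
  refine (ContinuousLinearMap.le_of_opNorm_le _ (norm_mulOp_le (hD n) (hpos n).le ?_) _).trans ?_
  · simpa only [Complex.norm_real, Real.norm_eq_abs] using hVW n
  · gcongr
    exact norm_invSqrtLaplacian_le d u

theorem eLpNorm_two_sq {α E : Type*} [MeasurableSpace α] {μ : Measure α} [NormedAddCommGroup E]
    (f : α → E) : eLpNorm f 2 μ ^ 2 = ∫⁻ x, ‖f x‖ₑ ^ 2 ∂μ := by
  have := eLpNorm_nnreal_pow_eq_lintegral (μ := μ) (f := f) (p := 2) two_ne_zero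
  simp only [NNReal.coe_ofNat, ENNReal.rpow_ofNat] at this
  exact this

theorem enorm_sq_eq_lintegral {d : ℕ} (u : L2Space d) : ‖u‖ₑ ^ 2 = ∫⁻ x, ‖u x‖ₑ ^ 2 := by
  rw [Lp.enorm_def, eLpNorm_two_sq]

theorem potentialBounded_of_lintegral_le {d : ℕ} {V : RSpace d → ℝ} (hV : AEStronglyMeasurable V)
    {C : ℝ≥0∞} (hC : C ≠ ∞)
    (h : ∀ u : L2Space d, ∫⁻ x, ‖V x‖ₑ ^ 2 * ‖invSqrtLaplacian d u x‖ₑ ^ 2 ≤ C * ‖u‖ₑ ^ 2) :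
    PotentialBounded V := by
  have hm : ∀ u : L2Space d, AEStronglyMeasurable
      (fun x => (V x : ℂ) * invSqrtLaplacian d u x) volume := fun u =>
    (Complex.continuous_ofReal.comp_aestronglyMeasurable hV).mul (Lp.memLp _).1
  have hn : ∀ u : L2Space d,
      eLpNorm (fun x => (V x : ℂ) * invSqrtLaplacian d u x) 2 volume ^ 2 ≤ C * ‖u‖ₑ ^ 2 := by
    intro u
    refine le_trans (le_of_eq ?_) (h u)
    rw [eLpNorm_two_sq]
    refine lintegral_congr fun x => ?_
    rw [enorm_mul, mul_pow]
    congr 2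
    rw [← ofReal_norm, Complex.norm_real, ofReal_norm]
  have hmem : ∀ u : L2Space d, MemLp (fun x => (V x : ℂ) * invSqrtLaplacian d u x) 2 := by
    refine fun u => ⟨hm u, ?_⟩
    have h2 : C * ‖u‖ₑ ^ 2 < ∞ := ENNReal.mul_lt_top hC.lt_top (by simp)
    simpa using (hn u).trans_lt h2
  let T : L2Space d →ₗ[ℂ] L2Space d :=
    { toFun := fun u => (hmem u).toLp
      map_add' := fun u v => by
        rw [← MemLp.toLp_add]
        refine MemLp.toLp_congr _ _ ?_
        filter_upwards [Lp.coeFn_add (invSqrtLaplacian d u) (invSqrtLaplacian d v)] with x hx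
        rw [map_add, hx, Pi.add_apply, Pi.add_apply, mul_add]
      map_smul' := fun a u => by
        rw [RingHom.id_apply, ← MemLp.toLp_const_smul]
        refine MemLp.toLp_congr _ _ ?_
        filter_upwards [Lp.coeFn_smul a (invSqrtLaplacian d u)] with x hx
        rw [map_smul, hx, Pi.smul_apply, Pi.smul_apply, smul_eq_mul, smul_eq_mul]
        ring }
  refine ⟨T.mkContinuous (Real.sqrt C.toReal) fun u => ?_, fun u => (hmem u).coeFn_toLp⟩
  refine (pow_le_pow_iff_left₀ (norm_nonneg _) (by positivity) two_ne_zero).1 ?_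
  rw [mul_pow, Real.sq_sqrt ENNReal.toReal_nonneg]
  have h3 : ‖T u‖ₑ ^ 2 ≤ C * ‖u‖ₑ ^ 2 := by
    refine le_trans (le_of_eq ?_) (hn u)
    exact congrArg (· ^ 2) (Lp.enorm_toLp (hmem u))
  have h4 := ENNReal.toReal_mono (ENNReal.mul_ne_top hC (by simp)) h3
  simpa using h4

/-! ### Cauchy–Schwarz and Young inequalities -/

theorem ENNReal.sq_sum_mul_le {ι : Type*} (s : Finset ι) (w f : ι → ℝ≥0∞) :
    (∑ i ∈ s, w i * f i) ^ 2 ≤ (∑ i ∈ s, w i) * ∑ i ∈ s, w i * f i ^ 2 := by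
  have h := ENNReal.inner_le_weight_mul_Lp_of_nonneg s one_le_two w f
  refine (pow_le_pow_left₀ zero_le h 2).trans_eq ?_
  rw [mul_pow, ← ENNReal.rpow_ofNat, ← ENNReal.rpow_ofNat, ← ENNReal.rpow_mul, ← ENNReal.rpow_mul]
  norm_num

theorem tsum_ite_le_pow_sub (r : ℝ≥0∞) (k : ℕ) :
    ∑' j, (if k ≤ j then r ^ (j - k) else 0) = ∑' i, r ^ i := by
  rw [← (add_left_injective k).tsum_eq]
  · simp
  · intro j hj
    by_cases h : k ≤ j
    · exact ⟨j - k, by simp [h]⟩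
    · simp [h] at hj

/-- Young's inequality for the convolution with a geometric sequence. -/
theorem tsum_sq_sum_pow_mul_le (r : ℝ≥0∞) (x : ℕ → ℝ≥0∞) :
    ∑' j, (∑ k ∈ Finset.range (j + 1), r ^ (j - k) * x k) ^ 2
      ≤ (∑' i, r ^ i) ^ 2 * ∑' k, x k ^ 2 := by
  have h1 : ∀ j, (∑ k ∈ Finset.range (j + 1), r ^ (j - k) * x k) ^ 2
      ≤ (∑' i, r ^ i) * ∑' k, (if k ≤ j then r ^ (j - k) else 0) * x k ^ 2 := by
    intro j
    -- Cauchy–Schwarz with weights `r ^ (j - k)`, whose total is at most the geometric series;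
    -- summing over `j` afterwards gives the second such factor.
    refine (ENNReal.sq_sum_mul_le _ _ _).trans (mul_le_mul' ?_ ?_)
    · have := Finset.sum_range_reflect (fun i => r ^ i) (j + 1)
      simp only [Nat.add_sub_cancel] at this
      rw [this]
      exact ENNReal.sum_le_tsum _
    · refine le_trans (le_of_eq (Finset.sum_congr rfl fun k hk => ?_)) (ENNReal.sum_le_tsum _)
      rw [if_pos (Nat.lt_succ_iff.1 (Finset.mem_range.1 hk))]
  refine (ENNReal.tsum_le_tsum h1).trans_eq ?_
  rw [ENNReal.tsum_mul_left, ENNReal.tsum_comm]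
  simp only [ENNReal.tsum_mul_right, tsum_ite_le_pow_sub]
  rw [ENNReal.tsum_mul_left]
  ring

theorem sq_setLIntegral_le {α : Type*} [MeasurableSpace α] (μ : Measure α) (s : Set α)
    {f : α → ℝ≥0∞} (hf : AEMeasurable f μ) :
    (∫⁻ x in s, f x ∂μ) ^ 2 ≤ μ s * ∫⁻ x in s, f x ^ 2 ∂μ := by
  have h := ENNReal.lintegral_mul_le_Lp_mul_Lq (μ.restrict s) Real.HolderConjugate.two_two
    (f := fun _ => 1) (g := f) aemeasurable_const hf.restrict
  have h2 : ∫⁻ x in s, f x ∂μ ≤ (μ s) ^ (1 / 2 : ℝ) * (∫⁻ x in s, f x ^ 2 ∂μ) ^ (1 / 2 : ℝ) := by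
    simpa using h
  refine (pow_le_pow_left₀ zero_le h2 2).trans_eq ?_
  rw [mul_pow, ← ENNReal.rpow_ofNat, ← ENNReal.rpow_ofNat, ← ENNReal.rpow_mul, ← ENNReal.rpow_mul]
  norm_num

/-! ### Dyadic decomposition in frequency -/

/-- The ball of radius `2 ^ j`. -/
def dyadicBall (d j : ℕ) : Set (RSpace d) := Metric.ball 0 (2 ^ j)

/-- The dyadic annuli (and the unit ball). -/
def dyadicAnnulus (d : ℕ) : ℕ → Set (RSpace d) := disjointed (dyadicBall d)

theorem monotone_dyadicBall (d : ℕ) : Monotone (dyadicBall d) := fun _ _ h =>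
  Metric.ball_subset_ball (pow_le_pow_right₀ one_le_two h)

theorem measurableSet_dyadicBall (d j : ℕ) : MeasurableSet (dyadicBall d j) :=
  Metric.isOpen_ball.measurableSet

theorem dyadicAnnulus_succ (d k : ℕ) :
    dyadicAnnulus d (k + 1) = dyadicBall d (k + 1) \ dyadicBall d k :=
  (monotone_dyadicBall d).disjointed_add_one k

theorem enorm_invSqrtSymbol_le_of_mem_annulus {d k : ℕ} {ξ : RSpace d}
    (h : ξ ∈ dyadicAnnulus d k) : ‖invSqrtSymbol d ξ‖ₑ ^ 2 ≤ 4 * (4 ^ k)⁻¹ := by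
  have h1 : ‖invSqrtSymbol d ξ‖ ^ 2 ≤ 4 * (4 ^ k)⁻¹ := by
    cases k with
    | zero => nlinarith [norm_invSqrtSymbol_le_one ξ, norm_nonneg (invSqrtSymbol d ξ)]
    | succ k =>
      rw [dyadicAnnulus_succ] at h
      have h2 : (2 : ℝ) ^ k ≤ ‖ξ‖ := by simpa [dyadicBall] using h.2
      refine (pow_le_pow_left₀ (norm_nonneg _) (norm_invSqrtSymbol_le_inv (by positivity) h2)
        2).trans_eq ?_
      rw [inv_pow, ← pow_mul, mul_comm k 2, pow_mul, pow_succ]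
      norm_num
      field_simp
      ring
  have h2 := ENNReal.ofReal_le_ofReal h1
  rw [ENNReal.ofReal_pow (norm_nonneg _), ofReal_norm, ENNReal.ofReal_mul (by norm_num),
    ENNReal.ofReal_inv_of_pos (by positivity), ENNReal.ofReal_pow (by norm_num)] at h2
  simpa using h2

theorem tsum_lintegral_annulus_le {d : ℕ} (f : RSpace d → ℝ≥0∞) :
    ∑' k, ∫⁻ ξ in dyadicAnnulus d k, f ξ ≤ ∫⁻ ξ, f ξ := by
  unfold dyadicAnnulus
  rw [← lintegral_iUnion (fun k => MeasurableSet.disjointed (measurableSet_dyadicBall d) k)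
    (disjoint_disjointed _)]
  exact setLIntegral_le_lintegral _ _

theorem setLIntegral_dyadicBall_le {d : ℕ} (f : RSpace d → ℝ≥0∞) (j : ℕ) :
    ∫⁻ ξ in dyadicBall d j, f ξ
      ≤ ∑ k ∈ Finset.range (j + 1), ∫⁻ ξ in dyadicAnnulus d k, f ξ := by
  induction j with
  | zero => simp [dyadicAnnulus, disjointed_zero]
  | succ j ih =>
    rw [Finset.sum_range_succ]
    refine le_trans (lintegral_mono_set ?_) ((lintegral_union_le f (dyadicBall d j)
      (dyadicAnnulus d (j + 1))).trans (add_le_add_left ih _))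
    rw [dyadicAnnulus_succ, Set.union_sdiff_self]
    exact Set.subset_union_right

/-- Only `j` with `2 ^ j ≤ ‖ξ‖` contribute. Their geometric sum is at most twice its last term `4 ^
n`, which the decay of the symbol cancels. -/
theorem tsum_ite_four_pow_mul_le {d : ℕ} (ξ : RSpace d) :
    ∑' j, 4 ^ j * (dyadicBall d j)ᶜ.indicator (fun ξ => ‖invSqrtSymbol d ξ‖ₑ ^ 2) ξ ≤ 2 := by
  by_cases h1 : ‖ξ‖ < 1
  · have : ∀ j, ξ ∉ (dyadicBall d j)ᶜ := fun j => by
      simpa [dyadicBall] using h1.trans_le (one_le_pow₀ one_le_two)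
    simp [Set.indicator_of_notMem (this _)]
  · obtain ⟨n, hn1, hn2⟩ := exists_nat_pow_near (not_lt.1 h1) one_lt_two
    have h2 : ‖invSqrtSymbol d ξ‖ₑ ^ 2 ≤ (4 ^ n)⁻¹ := by
      have h3 : ‖invSqrtSymbol d ξ‖ ^ 2 ≤ (4 ^ n)⁻¹ := by
        refine (pow_le_pow_left₀ (norm_nonneg _) (norm_invSqrtSymbol_le_inv (by positivity) hn1)
          2).trans_eq ?_
        rw [inv_pow, ← pow_mul, mul_comm n 2, pow_mul]
        norm_num
      have h4 := ENNReal.ofReal_le_ofReal h3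
      rw [ENNReal.ofReal_pow (norm_nonneg _), ofReal_norm,
        ENNReal.ofReal_inv_of_pos (by positivity), ENNReal.ofReal_pow (by norm_num)] at h4
      simpa using h4
    have h5 : ∀ m : ℕ, ∑ j ∈ Finset.range (m + 1), (4 : ℝ≥0∞) ^ j ≤ 2 * 4 ^ m := by
      intro m
      induction m with
      | zero => simp
      | succ m ih =>
        rw [Finset.sum_range_succ]
        refine (add_le_add_left ih _).trans ?_
        rw [show (2 : ℝ≥0∞) * 4 ^ (m + 1) = 4 * 4 ^ m + 4 ^ (m + 1) by ring]
        gcongr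
        norm_num
    calc ∑' j, 4 ^ j * (dyadicBall d j)ᶜ.indicator (fun ξ => ‖invSqrtSymbol d ξ‖ₑ ^ 2) ξ
        = ∑ j ∈ Finset.range (n + 1),
            4 ^ j * (dyadicBall d j)ᶜ.indicator (fun ξ => ‖invSqrtSymbol d ξ‖ₑ ^ 2) ξ := by
          refine tsum_eq_sum fun j hj => ?_
          have hj' : n + 1 ≤ j := by simpa using hj
          have : ξ ∉ (dyadicBall d j)ᶜ := by
            simpa [dyadicBall] using hn2.trans_le (pow_le_pow_right₀ one_le_two hj')
          rw [Set.indicator_of_notMem this, mul_zero]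
      _ ≤ ∑ j ∈ Finset.range (n + 1), 4 ^ j * (4 ^ n)⁻¹ := by
          gcongr with j
          exact (Set.indicator_le_self _ _ _).trans h2
      _ ≤ 2 * 4 ^ n * (4 ^ n)⁻¹ := by
          rw [← Finset.sum_mul]
          gcongr
          exact h5 n
      _ = 2 := by
          rw [mul_assoc, ENNReal.mul_inv_cancel (by positivity) (by finiteness), mul_one]

theorem tsum_lintegral_high_le {d : ℕ} (v : L2Space d) :
    ∑' j, 4 ^ j * ∫⁻ ξ in (dyadicBall d j)ᶜ, ‖mulOp (memLp_invSqrtSymbol d) v ξ‖ₑ ^ 2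
      ≤ 2 * ‖v‖ₑ ^ 2 := by
  have hm : AEMeasurable (fun ξ => ‖v ξ‖ₑ ^ 2) (volume : Measure (RSpace d)) :=
    (Lp.memLp v).1.enorm.pow_const 2
  have hs : Measurable fun ξ => ‖invSqrtSymbol d ξ‖ₑ ^ 2 :=
    (continuous_invSqrtSymbol d).measurable.enorm.pow_const 2
  have h1 : ∀ j, 4 ^ j * ∫⁻ ξ in (dyadicBall d j)ᶜ, ‖mulOp (memLp_invSqrtSymbol d) v ξ‖ₑ ^ 2
      = ∫⁻ ξ, 4 ^ j * (dyadicBall d j)ᶜ.indicator (fun ξ => ‖invSqrtSymbol d ξ‖ₑ ^ 2) ξ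
        * ‖v ξ‖ₑ ^ 2 := by
    intro j
    rw [← lintegral_indicator (measurableSet_dyadicBall d j).compl,
      ← lintegral_const_mul' _ _ (by finiteness)]
    refine lintegral_congr_ae ?_
    filter_upwards [coeFn_mulOp (memLp_invSqrtSymbol d) v] with ξ h
    by_cases hξ : ξ ∈ (dyadicBall d j)ᶜ
    · rw [Set.indicator_of_mem hξ, Set.indicator_of_mem hξ, h, enorm_mul]
      ring
    · simp [Set.indicator_of_notMem hξ]
  simp only [h1]
  have h2 : ∀ j, AEMeasurable (fun ξ => 4 ^ j * (dyadicBall d j)ᶜ.indicator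
      (fun ξ => ‖invSqrtSymbol d ξ‖ₑ ^ 2) ξ * ‖v ξ‖ₑ ^ 2) volume := fun j =>
    ((hs.indicator (measurableSet_dyadicBall d j).compl).const_mul _).aemeasurable.mul hm
  rw [← lintegral_tsum h2]
  rw [enorm_sq_eq_lintegral, ← lintegral_const_mul' _ _ (by finiteness)]
  refine lintegral_mono fun ξ => ?_
  rw [ENNReal.tsum_mul_right]
  gcongr
  exact tsum_ite_four_pow_mul_le ξ

/-- By Cauchy–Schwarz on the `k`-th annulus, the squared `L¹` norm costs volume `2 ^ (d k)` and
gains `4 ^ (-k)` from the symbol; `hr` says that `r ^ (2 k)` pays for the balance. Writing `r ^ j =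
r ^ (j - k) * r ^ k` leaves a convolution for Young's inequality. -/
theorem tsum_lintegral_low_le {d : ℕ} {r : ℝ≥0∞} (hr : r ^ 2 * 2 ^ d ≤ 4) (v : L2Space d) :
    ∑' j, (r ^ j) ^ 2 * (∫⁻ ξ in dyadicBall d j, ‖mulOp (memLp_invSqrtSymbol d) v ξ‖ₑ) ^ 2
      ≤ (∑' i, r ^ i) ^ 2 * (4 * volume (dyadicBall d 0) * ‖v‖ₑ ^ 2) := by
  set w := mulOp (memLp_invSqrtSymbol d) v with hw
  set s : ℕ → ℝ≥0∞ := fun k => ∫⁻ ξ in dyadicAnnulus d k, ‖w ξ‖ₑ with hs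
  have hs2 : ∀ k, (r ^ k * s k) ^ 2
      ≤ 4 * volume (dyadicBall d 0) * ∫⁻ ξ in dyadicAnnulus d k, ‖v ξ‖ₑ ^ 2 := by
    intro k
    have h1 : s k ^ 2 ≤ ((2 ^ d) ^ k * volume (dyadicBall d 0))
        * (4 * (4 ^ k)⁻¹ * ∫⁻ ξ in dyadicAnnulus d k, ‖v ξ‖ₑ ^ 2) := by
      refine (sq_setLIntegral_le volume _ (Lp.memLp w).1.enorm).trans (mul_le_mul' ?_ ?_)
      · refine (measure_mono (disjointed_le _ k)).trans_eq ?_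
        have := Measure.addHaar_ball_of_pos (volume : Measure (RSpace d)) 0
          (show (0 : ℝ) < 2 ^ k by positivity)
        rw [dyadicBall, this, dyadicBall, pow_zero, finrank_euclideanSpace_fin, ← pow_mul,
          mul_comm k d, pow_mul, ENNReal.ofReal_pow (by positivity),
          ENNReal.ofReal_pow (by positivity)]
        simp
      · rw [← lintegral_const_mul' _ _ (by finiteness)]
        refine lintegral_mono_ae ?_
        filter_upwards [ae_restrict_of_ae (coeFn_mulOp (memLp_invSqrtSymbol d) v),
          ae_restrict_mem (MeasurableSet.disjointed (measurableSet_dyadicBall d) k)] with ξ h1 h2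
        rw [hw, h1, enorm_mul, mul_pow]
        gcongr
        exact enorm_invSqrtSymbol_le_of_mem_annulus h2
    calc (r ^ k * s k) ^ 2 = (r ^ 2) ^ k * s k ^ 2 := by ring
      _ ≤ (r ^ 2) ^ k * (((2 ^ d) ^ k * volume (dyadicBall d 0))
        * (4 * (4 ^ k)⁻¹ * ∫⁻ ξ in dyadicAnnulus d k, ‖v ξ‖ₑ ^ 2)) := by gcongr
      _ = ((r ^ 2 * 2 ^ d) ^ k * (4 ^ k)⁻¹) * (4 * volume (dyadicBall d 0)
        * ∫⁻ ξ in dyadicAnnulus d k, ‖v ξ‖ₑ ^ 2) := by ring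
      _ ≤ (4 ^ k * (4 ^ k)⁻¹) * (4 * volume (dyadicBall d 0)
        * ∫⁻ ξ in dyadicAnnulus d k, ‖v ξ‖ₑ ^ 2) := by gcongr
      _ = _ := by rw [ENNReal.mul_inv_cancel (by positivity) (by finiteness), one_mul]
  calc ∑' j, (r ^ j) ^ 2 * (∫⁻ ξ in dyadicBall d j, ‖w ξ‖ₑ) ^ 2
      ≤ ∑' j, (∑ k ∈ Finset.range (j + 1), r ^ (j - k) * (r ^ k * s k)) ^ 2 := by
        refine ENNReal.tsum_le_tsum fun j => ?_
        rw [← mul_pow]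
        refine pow_le_pow_left₀ zero_le ?_ 2
        refine (mul_le_mul_right (setLIntegral_dyadicBall_le _ j) _).trans_eq ?_
        rw [Finset.mul_sum]
        refine Finset.sum_congr rfl fun k hk => ?_
        rw [← mul_assoc, ← pow_add, Nat.sub_add_cancel (Nat.lt_succ_iff.1 (Finset.mem_range.1 hk))]
    _ ≤ (∑' i, r ^ i) ^ 2 * ∑' k, (r ^ k * s k) ^ 2 := tsum_sq_sum_pow_mul_le _ _
    _ ≤ (∑' i, r ^ i) ^ 2 * (4 * volume (dyadicBall d 0) * ‖v‖ₑ ^ 2) := by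
        refine mul_le_mul_right ((ENNReal.tsum_le_tsum hs2).trans ?_) _
        rw [ENNReal.tsum_mul_left, enorm_sq_eq_lintegral]
        gcongr
        exact tsum_lintegral_annulus_le _

/-! ### Level sets of weak `L^p` functions -/

/-- The set where `|V|` is of size `2 ^ j`. -/
def levelSet {d : ℕ} (V : RSpace d → ℝ) (j : ℕ) : Set (RSpace d) :=
  {x | 2 ^ j ≤ |V x| ∧ |V x| < 2 ^ (j + 1)}

theorem nullMeasurableSet_levelSet {d : ℕ} {V : RSpace d → ℝ} (hV : AEStronglyMeasurable V)
    (j : ℕ) : NullMeasurableSet (levelSet V j) :=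
  (nullMeasurableSet_le aemeasurable_const hV.norm.aemeasurable).inter
    (nullMeasurableSet_lt hV.norm.aemeasurable aemeasurable_const)

theorem setOf_one_le_subset {d : ℕ} (V : RSpace d → ℝ) :
    {x | 1 ≤ |V x|} ⊆ ⋃ j, levelSet V j := fun _ hx =>
  Set.mem_iUnion.2 (exists_nat_pow_near hx one_lt_two)

theorem enorm_sq_le_of_mem_levelSet {d : ℕ} {V : RSpace d → ℝ} {j : ℕ} {x : RSpace d}
    (hx : x ∈ levelSet V j) : ‖V x‖ₑ ^ 2 ≤ 4 * 4 ^ j := by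
  have h : |V x| ^ 2 ≤ 4 * 4 ^ j := by
    refine (pow_le_pow_left₀ (abs_nonneg _) hx.2.le 2).trans_eq ?_
    rw [← pow_mul, mul_comm, pow_mul, pow_succ]
    norm_num
    ring
  have h2 := ENNReal.ofReal_le_ofReal h
  rw [ENNReal.ofReal_pow (abs_nonneg _), ← Real.norm_eq_abs, ofReal_norm,
    ENNReal.ofReal_mul (by norm_num), ENNReal.ofReal_pow (by norm_num)] at h2
  simpa using h2

theorem MemWeakLp.measure_levelSet_le {d : ℕ} {V : RSpace d → ℝ} {p : ℝ} (hV : MemWeakLp V p) :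
    ∃ K : ℝ≥0∞, K ≠ ∞ ∧ ∀ j, 4 ^ j * volume (levelSet V j)
      ≤ K * (ENNReal.ofReal (2 ^ (1 - p / 2)) ^ j) ^ 2 := by
  obtain ⟨-, c, hc, h⟩ := hV
  refine ⟨ENNReal.ofReal (c ^ p * 2 ^ p), ENNReal.ofReal_ne_top, fun j => ?_⟩
  -- Halving the threshold gives the strict inequality of the weak `L^p` bound, at the cost of `2 ^
  -- p` in `K`.
  have hsub : levelSet V j ⊆ {x | 2 ^ j / 2 < |V x|} := fun x hx =>
    (half_lt_self (by positivity)).trans_le hx.1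
  refine (mul_le_mul_right ((measure_mono hsub).trans (h _ (by positivity))) _).trans_eq ?_
  have h4 : (4 : ℝ≥0∞) ^ j = ENNReal.ofReal (4 ^ j) := by
    rw [ENNReal.ofReal_pow (by norm_num)]
    simp
  rw [h4, ← ENNReal.ofReal_pow (by positivity), ← ENNReal.ofReal_pow (by positivity),
    ← ENNReal.ofReal_mul (by positivity), ← ENNReal.ofReal_mul (by positivity)]
  congr 1
  have h5 : ((2 : ℝ) ^ j / 2) ^ p = 2 ^ (j * p) / 2 ^ p := by
    rw [Real.div_rpow (by positivity) (by norm_num), ← Real.rpow_natCast, ← Real.rpow_mul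
      (by norm_num)]
  have h6 : (((2 : ℝ) ^ (1 - p / 2)) ^ j) ^ 2 = 4 ^ j / 2 ^ (j * p) := by
    rw [show (4 : ℝ) ^ j = 2 ^ ((2 * j : ℕ) : ℝ) by rw [Real.rpow_natCast, pow_mul]; norm_num,
      ← Real.rpow_sub (by norm_num), ← pow_mul, ← Real.rpow_natCast,
      ← Real.rpow_mul (by norm_num)]
    congr 1
    push_cast
    ring
  rw [h5, h6]
  field_simp

theorem tsum_pow_ofReal_ne_top {p : ℝ} (hp : 2 < p) :
    ∑' i, ENNReal.ofReal (2 ^ (1 - p / 2)) ^ i ≠ ∞ := by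
  rw [ENNReal.tsum_geometric, ne_eq, ENNReal.inv_eq_top, tsub_eq_zero_iff_le, not_le,
    ENNReal.ofReal_lt_one]
  exact Real.rpow_lt_one_of_one_lt_of_neg one_lt_two (by linarith)

theorem MemWeakLp.memLp_two_indicator {d : ℕ} {V : RSpace d → ℝ} {p : ℝ} (hp : 2 < p)
    (hV : MemWeakLp V p) : MemLp ({x | 1 ≤ |V x|}.indicator V) 2 := by
  have hm : NullMeasurableSet {x | 1 ≤ |V x|} :=
    nullMeasurableSet_le aemeasurable_const hV.1.norm.aemeasurable
  have h2 : (2 : ℝ≥0∞) ≠ 0 := two_ne_zero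
  refine ⟨hV.1.indicator₀ hm, ?_⟩
  suffices h : eLpNorm ({x | 1 ≤ |V x|}.indicator V) 2 volume ^ 2 < ∞ by simpa using h
  obtain ⟨K, hK, hle⟩ := hV.measure_levelSet_le
  rw [eLpNorm_two_sq]
  set r := ENNReal.ofReal (2 ^ (1 - p / 2)) with hr
  have hS := tsum_pow_ofReal_ne_top hp
  calc ∫⁻ x, ‖{x | 1 ≤ |V x|}.indicator V x‖ₑ ^ 2
      = ∫⁻ x in {x | 1 ≤ |V x|}, ‖V x‖ₑ ^ 2 := by
        rw [← lintegral_indicator₀ hm]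
        refine lintegral_congr fun x => ?_
        by_cases hx : x ∈ {x | 1 ≤ |V x|}
        · rw [Set.indicator_of_mem hx, Set.indicator_of_mem hx]
        · rw [Set.indicator_of_notMem hx, Set.indicator_of_notMem hx]
          simp
    _ ≤ ∑' j, ∫⁻ x in levelSet V j, ‖V x‖ₑ ^ 2 :=
        (lintegral_mono_set (setOf_one_le_subset V)).trans (lintegral_iUnion_le _ _)
    _ ≤ ∑' j, 4 * K * (∑' i, r ^ i) * r ^ j := by
        -- One factor `r ^ j` of the square is bounded by the whole series, so that only the series
        -- in `r` is needed.
        refine ENNReal.tsum_le_tsum fun j => ?_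
        have h1 : ∫⁻ x in levelSet V j, ‖V x‖ₑ ^ 2 ≤ ∫⁻ x in levelSet V j, 4 * 4 ^ j := by
          refine lintegral_mono_ae ?_
          filter_upwards [ae_restrict_mem₀ (nullMeasurableSet_levelSet hV.1 j)] with x hx
          exact enorm_sq_le_of_mem_levelSet hx
        refine h1.trans ?_
        rw [setLIntegral_const, mul_assoc]
        calc 4 * (4 ^ j * volume (levelSet V j)) ≤ 4 * (K * (r ^ j) ^ 2) :=
              mul_le_mul_right (hle j) 4
          _ = 4 * K * r ^ j * r ^ j := by ring
          _ ≤ 4 * K * (∑' i, r ^ i) * r ^ j := by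
              gcongr
              exact ENNReal.le_tsum j
    _ < ∞ := by
        rw [ENNReal.tsum_mul_left]
        finiteness

/-! ### Boundedness for weak `L^p` potentials -/

/-- Splitting into low and high frequencies. -/
theorem setLIntegral_fourierInv_le {d : ℕ} (w : L2Space d) {B : Set (RSpace d)}
    (hB : MeasurableSet B) (hB' : volume B ≠ ∞) (E : Set (RSpace d)) :
    ∫⁻ x in E, ‖(𝓕⁻ w : L2Space d) x‖ₑ ^ 2
      ≤ 2 * (volume E * (∫⁻ ξ in B, ‖w ξ‖ₑ) ^ 2) + 2 * ∫⁻ ξ in Bᶜ, ‖w ξ‖ₑ ^ 2 := by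
  have hl : MemLp (B.indicator w) 2 := (Lp.memLp w).indicator hB
  have hh : MemLp (Bᶜ.indicator w) 2 := (Lp.memLp w).indicator hB.compl
  have hsum : w = hl.toLp + hh.toLp := by
    refine Lp.ext ?_
    filter_upwards [hl.coeFn_toLp, hh.coeFn_toLp, Lp.coeFn_add hl.toLp hh.toLp] with ξ h1 h2 h3
    rw [h3, Pi.add_apply, h1, h2, ← Pi.add_apply, Set.indicator_self_add_compl]
  have hint : Integrable (hl.toLp : L2Space d) := by
    refine Integrable.congr ?_ hl.coeFn_toLp.symm
    rw [integrable_indicator_iff hB]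
    have : IsFiniteMeasure (volume.restrict B) := ⟨by simpa using hB'.lt_top⟩
    exact memLp_one_iff_integrable.1 (((Lp.memLp w).restrict B).mono_exponent one_le_two)
  have hlow : ∀ᵐ x, ‖(𝓕⁻ (hl.toLp : L2Space d) : L2Space d) x‖ₑ ≤ ∫⁻ ξ in B, ‖w ξ‖ₑ := by
    filter_upwards [coeFn_fourierInv_ae_eq _ hint] with x hx
    rw [hx]
    refine (enorm_fourierInv_le _ x).trans_eq ?_
    rw [← lintegral_indicator hB]
    refine lintegral_congr_ae ?_
    filter_upwards [hl.coeFn_toLp] with ξ h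
    rw [h, enorm_indicator_eq_indicator_enorm]
  have hhigh : ∫⁻ x, ‖(𝓕⁻ (hh.toLp : L2Space d) : L2Space d) x‖ₑ ^ 2 = ∫⁻ ξ in Bᶜ, ‖w ξ‖ₑ ^ 2 := by
    rw [← enorm_sq_eq_lintegral, ← ofReal_norm, norm_fourierInv_L2, ofReal_norm,
      enorm_sq_eq_lintegral, ← lintegral_indicator hB.compl]
    refine lintegral_congr_ae ?_
    filter_upwards [hh.coeFn_toLp] with ξ h
    rw [h, enorm_indicator_eq_indicator_enorm]
    by_cases hξ : ξ ∈ Bᶜ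
    · rw [Set.indicator_of_mem hξ, Set.indicator_of_mem hξ]
    · rw [Set.indicator_of_notMem hξ, Set.indicator_of_notMem hξ]
      simp
  have hadd : (𝓕⁻ w : L2Space d) = 𝓕⁻ (hl.toLp : L2Space d) + 𝓕⁻ (hh.toLp : L2Space d) := by
    conv_lhs => rw [hsum]
    exact (Lp.fourierTransformₗᵢ (RSpace d) ℂ).symm.map_add _ _
  have hpt : ∀ᵐ x, ‖(𝓕⁻ w : L2Space d) x‖ₑ ^ 2
      ≤ 2 * (∫⁻ ξ in B, ‖w ξ‖ₑ) ^ 2 + 2 * ‖(𝓕⁻ (hh.toLp : L2Space d) : L2Space d) x‖ₑ ^ 2 := by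
    rw [hadd]
    filter_upwards [hlow, Lp.coeFn_add (𝓕⁻ (hl.toLp : L2Space d)) (𝓕⁻ (hh.toLp : L2Space d))]
      with x h1 h2
    rw [h2, Pi.add_apply, ← mul_add]
    refine (pow_le_pow_left₀ zero_le ((enorm_add_le _ _).trans (add_le_add_left h1 _)) 2).trans ?_
    have := ENNReal.rpow_add_le_mul_rpow_add_rpow (∫⁻ ξ in B, ‖w ξ‖ₑ)
      ‖(𝓕⁻ (hh.toLp : L2Space d) : L2Space d) x‖ₑ one_le_two
    norm_num at this
    exact this
  refine (lintegral_mono_ae (ae_restrict_of_ae hpt)).trans ?_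
  rw [lintegral_add_left measurable_const, setLIntegral_const,
    lintegral_const_mul' _ _ ENNReal.ofNat_ne_top, ← hhigh]
  refine add_le_add (le_of_eq (by ring)) ?_
  gcongr
  exact Measure.restrict_le_self

/-- The part of `V` below `1` is bounded. On each level set of the rest, the frequency cutoff equals
the size of `V`, which makes both the low and the high sums converge. -/
theorem MemWeakLp.potentialBounded {d : ℕ} {V : RSpace d → ℝ} {p : ℝ} (hp : 2 < p)
    (hd : (d : ℝ) ≤ p) (hV : MemWeakLp V p) : PotentialBounded V := by
  have hm : NullMeasurableSet {x | 1 ≤ |V x|} :=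
    nullMeasurableSet_le aemeasurable_const hV.1.norm.aemeasurable
  have hsplit : V = {x | 1 ≤ |V x|}.indicator V + {x | 1 ≤ |V x|}ᶜ.indicator V :=
    (Set.indicator_self_add_compl _ _).symm
  rw [hsplit]
  refine potentialBounded_add ?_ (potentialBounded_of_memLp_top ?_)
  swap
  · refine memLp_top_of_bound (hV.1.indicator₀ hm.compl) 1 (ae_of_all _ fun x => ?_)
    by_cases hx : x ∈ {x | 1 ≤ |V x|}ᶜ
    · rw [Set.indicator_of_mem hx]
      exact (not_le.1 (show ¬1 ≤ |V x| from hx)).le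
    · rw [Set.indicator_of_notMem hx]
      simp
  obtain ⟨K, hK, hle⟩ := hV.measure_levelSet_le
  set r := ENNReal.ofReal (2 ^ (1 - p / 2)) with hr
  have hS := tsum_pow_ofReal_ne_top hp
  -- The left side is `2 ^ (2 - p + d)`, so this is exactly `d ≤ p`.
  have hr4 : r ^ 2 * 2 ^ d ≤ 4 := by
    have h1 : ((2 : ℝ) ^ (1 - p / 2)) ^ 2 * 2 ^ d ≤ 4 := by
      rw [← Real.rpow_natCast, ← Real.rpow_natCast, ← Real.rpow_mul (by norm_num),
        ← Real.rpow_add (by norm_num)]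
      refine (Real.rpow_le_rpow_of_exponent_le (y := ((1 - p / 2) * (2 : ℕ) + d)) (z := (2 : ℕ))
        one_le_two ?_).trans_eq ?_
      · push_cast
        linarith
      · rw [Real.rpow_natCast]
        norm_num
    have h2 := ENNReal.ofReal_le_ofReal h1
    rw [ENNReal.ofReal_mul (by positivity), ENNReal.ofReal_pow (by positivity),
      ENNReal.ofReal_pow (by positivity)] at h2
    simpa using h2
  have hB0 : volume (dyadicBall d 0) ≠ ∞ := measure_ball_lt_top.ne
  refine potentialBounded_of_lintegral_le (hV.1.indicator₀ hm)
    (C := 8 * K * ((∑' i, r ^ i) ^ 2 * (4 * volume (dyadicBall d 0))) + 8 * 2) (by finiteness)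
    fun u => ?_
  set v := 𝓕 u with hv
  set w := mulOp (memLp_invSqrtSymbol d) v with hw
  have hu : ‖u‖ₑ = ‖v‖ₑ := by rw [← ofReal_norm, ← ofReal_norm, hv, Lp.norm_fourier_eq]
  have hlevel : ∀ j, ∫⁻ x in levelSet V j, ‖V x‖ₑ ^ 2 * ‖invSqrtLaplacian d u x‖ₑ ^ 2
      ≤ 8 * K * ((r ^ j) ^ 2 * (∫⁻ ξ in dyadicBall d j, ‖w ξ‖ₑ) ^ 2)
        + 8 * (4 ^ j * ∫⁻ ξ in (dyadicBall d j)ᶜ, ‖w ξ‖ₑ ^ 2) := by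
    intro j
    calc ∫⁻ x in levelSet V j, ‖V x‖ₑ ^ 2 * ‖invSqrtLaplacian d u x‖ₑ ^ 2
        ≤ 4 * 4 ^ j * ∫⁻ x in levelSet V j, ‖(𝓕⁻ w : L2Space d) x‖ₑ ^ 2 := by
          rw [← lintegral_const_mul' _ _ (by finiteness)]
          refine lintegral_mono_ae ?_
          filter_upwards [ae_restrict_mem₀ (nullMeasurableSet_levelSet hV.1 j)] with x hx
          exact mul_le_mul_left (enorm_sq_le_of_mem_levelSet hx) _
      _ ≤ 4 * 4 ^ j * (2 * (volume (levelSet V j) * (∫⁻ ξ in dyadicBall d j, ‖w ξ‖ₑ) ^ 2)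
            + 2 * ∫⁻ ξ in (dyadicBall d j)ᶜ, ‖w ξ‖ₑ ^ 2) := by
          gcongr
          exact setLIntegral_fourierInv_le w (measurableSet_dyadicBall d j)
            measure_ball_lt_top.ne _
      _ = 8 * (4 ^ j * volume (levelSet V j)) * (∫⁻ ξ in dyadicBall d j, ‖w ξ‖ₑ) ^ 2
          + 8 * (4 ^ j * ∫⁻ ξ in (dyadicBall d j)ᶜ, ‖w ξ‖ₑ ^ 2) := by ring
      _ ≤ 8 * (K * (r ^ j) ^ 2) * (∫⁻ ξ in dyadicBall d j, ‖w ξ‖ₑ) ^ 2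
          + 8 * (4 ^ j * ∫⁻ ξ in (dyadicBall d j)ᶜ, ‖w ξ‖ₑ ^ 2) :=
          add_le_add_left (mul_le_mul_left (mul_le_mul_right (hle j) 8) _) _
      _ = _ := by ring
  calc ∫⁻ x, ‖{x | 1 ≤ |V x|}.indicator V x‖ₑ ^ 2 * ‖invSqrtLaplacian d u x‖ₑ ^ 2
      = ∫⁻ x in {x | 1 ≤ |V x|}, ‖V x‖ₑ ^ 2 * ‖invSqrtLaplacian d u x‖ₑ ^ 2 := by
        rw [← lintegral_indicator₀ hm]
        refine lintegral_congr fun x => ?_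
        by_cases hx : x ∈ {x | 1 ≤ |V x|}
        · rw [Set.indicator_of_mem hx, Set.indicator_of_mem hx]
        · rw [Set.indicator_of_notMem hx, Set.indicator_of_notMem hx]
          simp
    _ ≤ ∑' j, ∫⁻ x in levelSet V j, ‖V x‖ₑ ^ 2 * ‖invSqrtLaplacian d u x‖ₑ ^ 2 :=
        (lintegral_mono_set (setOf_one_le_subset V)).trans (lintegral_iUnion_le _ _)
    _ ≤ ∑' j, (8 * K * ((r ^ j) ^ 2 * (∫⁻ ξ in dyadicBall d j, ‖w ξ‖ₑ) ^ 2)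
        + 8 * (4 ^ j * ∫⁻ ξ in (dyadicBall d j)ᶜ, ‖w ξ‖ₑ ^ 2)) := ENNReal.tsum_le_tsum hlevel
    _ ≤ 8 * K * ((∑' i, r ^ i) ^ 2 * (4 * volume (dyadicBall d 0) * ‖v‖ₑ ^ 2))
        + 8 * (2 * ‖v‖ₑ ^ 2) := by
        rw [ENNReal.tsum_add, ENNReal.tsum_mul_left, ENNReal.tsum_mul_left]
        gcongr
        · exact tsum_lintegral_low_le hr4 v
        · exact tsum_lintegral_high_le v
    _ = _ := by
        rw [hu]
        ring

/-! ### Approximation and reduction to `L^p` -/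

theorem MemWeakLp.div_const {d : ℕ} {V : RSpace d → ℝ} {p ε : ℝ} (hε : 0 < ε)
    (hV : MemWeakLp V p) : MemWeakLp (fun x => V x / ε) p := by
  obtain ⟨hm, c, hc, h⟩ := hV
  refine ⟨by simpa only [div_eq_mul_inv] using hm.mul_const ε⁻¹, c / ε, by positivity, fun t ht => ?_⟩
  have h1 : {x | t < |V x / ε|} = {x | t * ε < |V x|} := by
    ext x
    simp [abs_div, abs_of_pos hε, lt_div_iff₀ hε]
  rw [h1]
  refine (h _ (by positivity)).trans_eq ?_
  rw [Real.div_rpow hc.le hε.le, Real.mul_rpow ht.le hε.le]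
  congr 1
  field_simp

/-- The witness is `V` cut off to `|V| ≥ ε`, obtained by rescaling the threshold `1`. -/
theorem MemWeakLp.exists_memLp_two {d : ℕ} {V : RSpace d → ℝ} {p : ℝ} (hp : 2 < p)
    (hV : MemWeakLp V p) {ε : ℝ} (hε : 0 < ε) :
    ∃ W : RSpace d → ℝ, MemLp W 2 ∧ ∀ x, |V x - W x| ≤ ε := by
  refine ⟨_, ((hV.div_const hε).memLp_two_indicator hp).const_mul ε, fun x => ?_⟩
  by_cases hx : x ∈ {x | 1 ≤ |V x / ε|}
  · rw [Set.indicator_of_mem hx, mul_div_cancel₀ _ hε.ne', sub_self, abs_zero]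
    exact hε.le
  · rw [Set.indicator_of_notMem hx, mul_zero, sub_zero]
    have : |V x / ε| < 1 := not_le.1 hx
    rw [abs_div, abs_of_pos hε, div_lt_one hε] at this
    exact this.le

theorem MemWeakLp.potentialBounded_and_compact {d : ℕ} {V : RSpace d → ℝ} {p : ℝ} (hp : 2 < p)
    (hd : (d : ℝ) ≤ p) (hV : MemWeakLp V p) : PotentialBounded V ∧ PotentialCompact V :=
  have hb := hV.potentialBounded hp hd
  ⟨hb, hb.compact hV.1 fun _ hε =>
    let ⟨W, hW, h⟩ := hV.exists_memLp_two hp hε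
    ⟨W, hW, ae_of_all _ h⟩⟩

theorem MemWeakLp.of_memLp {d : ℕ} {V : RSpace d → ℝ} {p : ℝ} (hp : 0 < p)
    (hV : MemLp V (ENNReal.ofReal p)) : MemWeakLp V p := by
  -- Chebyshev's inequality; the added `1` keeps the constant positive when `V` vanishes almost
  -- everywhere.
  refine ⟨hV.1, (eLpNorm V (ENNReal.ofReal p) volume).toReal + 1, by positivity, fun t ht => ?_⟩
  have h := mul_meas_ge_le_pow_eLpNorm' (μ := volume) (by simpa using hp) ENNReal.ofReal_ne_top
    hV.1 (ENNReal.ofReal t)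
  rw [ENNReal.toReal_ofReal hp.le] at h
  have hsub : {x | t < |V x|} ⊆ {x | ENNReal.ofReal t ≤ ‖V x‖₊} := fun x hx => by
    have : ENNReal.ofReal t ≤ ENNReal.ofReal ‖V x‖ :=
      ENNReal.ofReal_le_ofReal (show t < |V x| from hx).le
    rwa [ofReal_norm] at this
  rw [ENNReal.ofReal_div_of_pos (by positivity), ENNReal.le_div_iff_mul_le
    (Or.inl (by simp; positivity)) (Or.inl ENNReal.ofReal_ne_top), mul_comm,
    ← ENNReal.ofReal_rpow_of_pos ht, ← ENNReal.ofReal_rpow_of_pos (by positivity)]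
  refine (mul_le_mul_right (measure_mono hsub) _).trans (h.trans ?_)
  gcongr
  rw [ENNReal.le_ofReal_iff_toReal_le hV.2.ne (by positivity)]
  linarith

theorem ae_abs_sub_le {d : ℕ} {V g : RSpace d → ℝ} {ε : ℝ} (hε : 0 ≤ ε)
    (h : eLpNorm (V - g) ∞ volume ≤ ENNReal.ofReal ε) : ∀ᵐ x, |V x - g x| ≤ ε := by
  rw [eLpNorm_exponent_top] at h
  filter_upwards [ae_le_eLpNormEssSup (f := V - g)] with x hx
  have := hx.trans h
  rwa [← ofReal_norm, ENNReal.ofReal_le_ofReal_iff hε] at this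

theorem MemLpAddLinfZero.exists_approx {d : ℕ} {V : RSpace d → ℝ} {p : ℝ≥0∞}
    (hV : MemLpAddLinfZero V p) {ε : ℝ} (hε : 0 < ε) :
    ∃ g : RSpace d → ℝ, MemLp g p ∧ ∀ᵐ x, |V x - g x| ≤ ε := by
  obtain ⟨-, g, hg, hlim⟩ := hV
  obtain ⟨n, hn⟩ := (hlim.eventually_lt_const (ENNReal.ofReal_pos.2 hε)).exists
  exact ⟨g n, hg n, ae_abs_sub_le hε.le hn.le⟩

theorem MemLpAddLinfZero.potentialBounded {d : ℕ} {V : RSpace d → ℝ} {p : ℝ≥0∞}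
    (hV : MemLpAddLinfZero V p) (h : ∀ g : RSpace d → ℝ, MemLp g p → PotentialBounded g) :
    PotentialBounded V := by
  obtain ⟨g, hg, hVg⟩ := hV.exists_approx one_pos
  rw [← add_sub_cancel g V]
  exact potentialBounded_add (h g hg)
    (potentialBounded_of_memLp_top (memLp_top_of_bound (hV.1.sub hg.1) 1 hVg))

/-! ### Dimension one, the Coulomb potential, conclusion -/

theorem memLp_two_invSqrtSymbol_one : MemLp (invSqrtSymbol 1) 2 volume := by
  rw [memLp_two_iff_integrable_sq_norm (continuous_invSqrtSymbol 1).aestronglyMeasurable]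
  have h := integrable_rpow_neg_one_add_norm_sq (E := RSpace 1) (μ := volume) (r := 2)
    (by rw [finrank_euclideanSpace_fin]; norm_num)
  refine h.mono' ((continuous_invSqrtSymbol 1).norm.pow 2).aestronglyMeasurable
    (ae_of_all _ fun ξ => ?_)
  rw [norm_invSqrtSymbol, Real.norm_of_nonneg (by positivity), ← Real.rpow_natCast,
    ← Real.rpow_mul (by positivity), show (-(1 / 2) : ℝ) * (2 : ℕ) = -2 / 2 by norm_num]
  refine Real.rpow_le_rpow_of_nonpos (by positivity) ?_ (by norm_num)
  have : ‖ξ‖ ≤ 2 * Real.pi * ‖ξ‖ := by nlinarith [Real.pi_gt_three, norm_nonneg ξ]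
  gcongr

/-- By Cauchy–Schwarz the Fourier transform of `invSqrtLaplacian d u` is in `L¹`, so that function
is essentially bounded by a multiple of `‖u‖`. -/
theorem potentialBounded_of_memLp_two {d : ℕ} (hm : MemLp (invSqrtSymbol d) 2)
    {V : RSpace d → ℝ} (hV : MemLp V 2) : PotentialBounded V := by
  have hV2 : ∫⁻ x, ‖V x‖ₑ ^ 2 ≠ ∞ := by
    rw [← eLpNorm_two_sq]
    exact ENNReal.pow_ne_top hV.2.ne
  have hm2 : ∫⁻ x, ‖invSqrtSymbol d x‖ₑ ^ 2 ≠ ∞ := by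
    rw [← eLpNorm_two_sq]
    exact ENNReal.pow_ne_top hm.2.ne
  refine potentialBounded_of_lintegral_le hV.1
    (C := (∫⁻ x, ‖V x‖ₑ ^ 2) * ∫⁻ x, ‖invSqrtSymbol d x‖ₑ ^ 2) (by finiteness) fun u => ?_
  set v := 𝓕 u with hv
  set w := mulOp (memLp_invSqrtSymbol d) v with hw
  have hu : ‖u‖ₑ = ‖v‖ₑ := by rw [← ofReal_norm, ← ofReal_norm, hv, Lp.norm_fourier_eq]
  have hwi : Integrable w := by
    refine Integrable.congr ?_ (coeFn_mulOp (memLp_invSqrtSymbol d) v).symm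
    exact hm.integrable_mul (Lp.memLp v)
  have hw1 : (∫⁻ ξ, ‖w ξ‖ₑ) ^ 2 ≤ (∫⁻ x, ‖invSqrtSymbol d x‖ₑ ^ 2) * ‖v‖ₑ ^ 2 := by
    have h1 : ∫⁻ ξ, ‖w ξ‖ₑ = ∫⁻ ξ, ((fun ξ => ‖invSqrtSymbol d ξ‖ₑ) * fun ξ => ‖v ξ‖ₑ) ξ := by
      refine lintegral_congr_ae ?_
      filter_upwards [coeFn_mulOp (memLp_invSqrtSymbol d) v] with ξ h
      rw [hw, h, enorm_mul, Pi.mul_apply]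
    have h2 := ENNReal.lintegral_mul_le_Lp_mul_Lq volume Real.HolderConjugate.two_two
      hm.1.enorm (Lp.memLp v).1.enorm
    rw [← h1] at h2
    refine (pow_le_pow_left₀ zero_le h2 2).trans_eq ?_
    rw [enorm_sq_eq_lintegral, mul_pow, ← ENNReal.rpow_ofNat, ← ENNReal.rpow_ofNat,
      ← ENNReal.rpow_mul, ← ENNReal.rpow_mul]
    norm_num
  calc ∫⁻ x, ‖V x‖ₑ ^ 2 * ‖invSqrtLaplacian d u x‖ₑ ^ 2
      ≤ ∫⁻ x, ‖V x‖ₑ ^ 2 * ((∫⁻ x, ‖invSqrtSymbol d x‖ₑ ^ 2) * ‖v‖ₑ ^ 2) := by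
        refine lintegral_mono_ae ?_
        filter_upwards [coeFn_fourierInv_ae_eq w hwi] with x hx
        refine mul_le_mul_right (le_trans ?_ hw1) _
        rw [show invSqrtLaplacian d u = 𝓕⁻ w from rfl, hx]
        exact pow_le_pow_left₀ zero_le (enorm_fourierInv_le _ x) 2
    _ = _ := by
        rw [lintegral_mul_const' _ _ (by finiteness), hu, mul_assoc]

theorem memWeakLp_coulomb : MemWeakLp (fun x : RSpace 3 => 1 / ‖x‖) 3 := by
  refine ⟨(measurable_const.div measurable_norm).aestronglyMeasurable,
    (volume (Metric.ball (0 : RSpace 3) 1)).toReal ^ (1 / 3 : ℝ),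
    ?_, fun t ht => ?_⟩
  · exact Real.rpow_pos_of_pos (ENNReal.toReal_pos (Metric.measure_ball_pos _ _ one_pos).ne'
      measure_ball_lt_top.ne) _
  have hsub : {x : RSpace 3 | t < |1 / ‖x‖|} ⊆ Metric.ball 0 t⁻¹ := fun x hx => by
    have h1 : t < |1 / ‖x‖| := hx
    -- The origin is not in the set, because `1 / 0 = 0`.
    have h2 : 0 < ‖x‖ := by
      refine (norm_nonneg x).lt_of_ne' fun h0 => ?_
      rw [h0] at h1
      simp at h1
      linarith
    rw [abs_of_pos (by positivity), lt_div_iff₀ h2] at h1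
    rw [mem_ball_zero_iff, ← one_div, lt_div_iff₀ ht]
    linarith
  refine (measure_mono hsub).trans_eq ?_
  rw [Measure.addHaar_ball_of_pos _ _ (by positivity), finrank_euclideanSpace_fin,
    ← Real.rpow_mul ENNReal.toReal_nonneg, div_eq_inv_mul,
    ENNReal.ofReal_mul (by positivity)]
  norm_num

theorem MemWeakLp.neg {d : ℕ} {V : RSpace d → ℝ} {p : ℝ} (hV : MemWeakLp V p) :
    MemWeakLp (fun x => -V x) p := by
  obtain ⟨hm, c, hc, h⟩ := hV
  exact ⟨hm.neg, c, hc, by simpa using h⟩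

theorem mainTheorem6 :
    -- dimension one
    (∀ V : RSpace 1 → ℝ, MemLpAddLinfZero V 2 →
      PotentialBounded V ∧ PotentialCompact V) ∧
    -- dimension two
    (∀ (p : ℝ) (V : RSpace 2 → ℝ), 2 < p → MemLpAddLinfZero V (ENNReal.ofReal p) →
      PotentialBounded V ∧ PotentialCompact V) ∧
    -- dimension at least three
    (∀ (d : ℕ) (V : RSpace d → ℝ), 3 ≤ d → MemWeakLp V (d : ℝ) →
      PotentialBounded V ∧ PotentialCompact V) ∧
    -- the repulsive and attractive Coulomb potentials in dimension three
    (∀ V : RSpace 3 → ℝ, (V = fun x => 1 / ‖x‖) ∨ (V = fun x => -(1 / ‖x‖)) →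
      PotentialEven V ∧ PotentialBounded V ∧ PotentialCompact V) := by
  refine ⟨fun V hV => ?_, fun p V hp hV => ?_, fun d V hd hV => ?_, ?_⟩
  · have hb := hV.potentialBounded fun g hg =>
      potentialBounded_of_memLp_two memLp_two_invSqrtSymbol_one hg
    exact ⟨hb, hb.compact hV.1 fun ε hε => hV.exists_approx hε⟩
  · have hb := hV.potentialBounded fun g hg =>
      (MemWeakLp.of_memLp (by linarith) hg).potentialBounded hp (by exact_mod_cast hp.le)
    refine ⟨hb, hb.compact hV.1 fun ε hε => ?_⟩
    -- Half of `ε` goes to approximation in `L^p`, half to cutting the `L^p` function down to `L²`.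
    obtain ⟨g, hg, hVg⟩ := hV.exists_approx (half_pos hε)
    obtain ⟨W, hW, hgW⟩ :=
      (MemWeakLp.of_memLp (by linarith) hg).exists_memLp_two hp (half_pos hε)
    refine ⟨W, hW, ?_⟩
    filter_upwards [hVg] with x hx
    linarith [abs_sub_le (V x) (g x) (W x), hgW x]
  · have hd' : (3 : ℝ) ≤ d := by exact_mod_cast hd
    exact hV.potentialBounded_and_compact (by linarith) le_rfl
  · have h3 : ((3 : ℕ) : ℝ) ≤ 3 := by norm_num
    rintro V (rfl | rfl)
    · exact ⟨fun x => by simp, memWeakLp_coulomb.potentialBounded_and_compact (by norm_num) h3⟩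
    · exact ⟨fun x => by simp,
        memWeakLp_coulomb.neg.potentialBounded_and_compact (by norm_num) h3⟩
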